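/- Let $\mathcal S,\mathcal A$ be finite sets, $S=|\mathcal S|$, and let $P_1,\dots,P_M$ be transition functions on $\mathcal S\times\mathcal A$, where $P_i(\cdot\mid s,a)$ is the law of the next state. Let $0<\lambda\le 2$ (the upper bound is automatic if $M\ge 2$) and suppose that the family is $\lambda$-separable: for all $i\ne j$ there is a pair $(s,a)$ with $\|P_i(\cdot\mid s,a)-P_j(\cdot\mid s,a)\|_1\ge\lambda$. Let $\Gamma^\alpha\subseteq\mathcal S\times\mathcal A$ be an $\alpha$-distinguishing set: for all $i\neq j$ it contains a pair $(s,a)$ with $\|P_i(\cdot\mid s,a)-P_j(\cdot\mid s,a)\|_1\ge\alpha$. Suppose that the hitting time of each of the $M$ MDPs is at most $\tilde D$, i.e. $\mathbb E[T_{s,s'}]\le\tilde D$ for all $s,s'\in\mathcal S$ and every stationary policy $\pi:\mathcal S\to\mathcal A$, where $T_{s,s'}=\inf\{t>0: s_t=s'\}$ is the first passage time of the Markov chain induced by $\pi$, started at $s_0=s$. A learner interacts with an adversary in $K$ episodes of $H$ steps. At the start of episode $k$ the adversary chooses, possibly adaptively and at random, the task $m^k\in\{1,\dots,M\}$ and the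 initial state $s_1^k$; within the episode states evolve according to $P_{m^k}$. Let $p_1\in(0,1)$ and $$N=\frac{256}{\lambda^2}\max\Big\{S,\ln\frac{K|\Gamma^\alpha|}{p_1}\Big\},\qquad H_0=12\tilde D|\Gamma^\alpha|N=\frac{3072\,\tilde D|\Gamma^\alpha|}{\lambda^2}\max\Big\{S,\ln\frac{K|\Gamma^\alpha|}{p_1}\Big\},$$ and assume $H_0\le H$. In the clustering phase, i.e. the first $\lfloor H_0\rfloor$ steps of each episode, the learner follows ExploreID: let $\mathcal B$ be the collection of samples (state, action, next state) gathered so far in the current episode, let $N_{\mathcal B}(s,a)$ and $N_{\mathcal B}(s,a,s')$ be the numbers of samples in $\mathcal B$ that begin with $(s,a)$, respectively equal $(s,a,s')$, let $\hat P(s'\mid s,a)=N_{\mathcal B}(s,a,s')/N_{\mathcal B}(s,a)$ if $N_{\mathcal B}(s,a)>0$ and $\hat P(s'\mid s,a)=0$ otherwise, and let $\mathcal G(s)=\{a:(s,a)\in\Gamma^\alpha,\ N_{\mathcal B}(s,a)<N\}$. In state $s$, ExploreID takes an action in $\arg\max_{a\in\mathcal G(s)}N_{\mathcal B}(s,a)$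 if $\mathcal G(s)\ne\emptyset$, and otherwise an action in $\arg\max_{a\in\mathcal A}\sum_{s'}\hat P(s'\mid s,a)\,\mathbb 1\{\mathcal G(s')\neq\emptyset\}$, with arbitrary tie-breaking. In the remaining steps of the episode the learner's policy is arbitrary. Then, with probability at least $1-p_1$, in each of the $K$ episodes every $(s,a)\in\Gamma^\alpha$ is visited at least $N$ times during the clustering phase. -/

import Mathlib

open scoped ENNReal

noncomputable section

namespace MultiTaskRL

/-! ### Markov chains, first passage times, hitting time of an MDP -/

/-- The law of `(s_1, ..., s_n)` for the Markov chain with transition function `κ` and `s_0 = s`. -/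
def chainPath {S : Type*} (κ : S → PMF S) : ℕ → S → PMF (List S)
  | 0, _ => PMF.pure []
  | n + 1, s => (κ s).bind fun x => (chainPath κ n x).map fun l => x :: l

/-- `ℙ(T_{s,s'} > n)` for the first passage time `T_{s,s'} = inf {t > 0 | s_t = s'}`, `s_0 = s`:
none of `s_1, ..., s_n` equals `s'`. -/
def passageTail {S : Type*} (κ : S → PMF S) (s s' : S) (n : ℕ) : ℝ≥0∞ :=
  (chainPath κ n s).toOuterMeasure {l | s' ∉ l}

/-- `𝔼[T_{s,s'}]`, the mean of an `ℕ ∪ {∞}`-valued variable as the sum of its tail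
probabilities `∑_{n ≥ 0} ℙ(T_{s,s'} > n)`; it is `∞` if `s'` is missed with positive probability. -/
def expectedPassage {S : Type*} (κ : S → PMF S) (s s' : S) : ℝ≥0∞ :=
  ∑' n : ℕ, passageTail κ s s' n

/-- The hitting time of the MDP with transition function `P` (`P s a` is the law of the next state):
the supremum over pairs of states and over stationary policies of the mean first passage time in
the Markov chain that the policy induces. -/
def hittingTime {S A : Type*} (P : S → A → PMF S) : ℝ≥0∞ :=
  ⨆ (s : S) (s' : S) (π : S → A), expectedPassage (fun x => P x (π x)) s s'

/-! ### Separability and distinguishing sets -/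

/-- The `ℓ¹` distance of two laws on a finite set. -/
def l1Dist {S : Type*} [Fintype S] (p q : PMF S) : ℝ :=
  ∑ x, |(p x).toReal - (q x).toReal|

/-- `Γ^lam_{i,j}`. -/
def pairDistinguishing {S A : Type*} [Fintype S] {M : ℕ} (P : Fin M → S → A → PMF S) (lam : ℝ)
    (i j : Fin M) : Set (S × A) :=
  {x | lam ≤ l1Dist (P i x.1 x.2) (P j x.1 x.2)}

def IsSeparable {S A : Type*} [Fintype S] {M : ℕ} (P : Fin M → S → A → PMF S) (lam : ℝ) : Prop :=
  ∀ i j, i ≠ j → (pairDistinguishing P lam i j).Nonempty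

def IsDistinguishingSet {S A : Type*} [Fintype S] {M : ℕ} (P : Fin M → S → A → PMF S) (α : ℝ)
    (Γ : Finset (S × A)) : Prop :=
  ∀ i j, i ≠ j → (pairDistinguishing P α i j ∩ (Γ : Set (S × A))).Nonempty

/-! ### Samples and the exploration rule -/

/-- A collection of samples `(s, a, s')`, in chronological order. -/
abbrev Batch (S A : Type*) := List (S × A × S)

/-- `N_B(s, a, s')`. -/
def transitionCount {S A : Type*} [DecidableEq S] [DecidableEq A] (B : Batch S A)
    (s : S) (a : A) (s' : S) : ℕ :=
  B.count (s, a, s')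

/-- `N_B(s, a)`. -/
def visitCount {S A : Type*} [Fintype S] [DecidableEq S] [DecidableEq A] (B : Batch S A)
    (s : S) (a : A) : ℕ :=
  ∑ s', transitionCount B s a s'

/-- The empirical transition function of `B`. -/
def empirical {S A : Type*} [Fintype S] [DecidableEq S] [DecidableEq A] (B : Batch S A)
    (s : S) (a : A) (s' : S) : ℝ :=
  if 0 < visitCount B s a then (transitionCount B s a s' : ℝ) / (visitCount B s a : ℝ) else 0

/-- `𝒢(s)`: the actions whose pair with `s` lies in `Γ` and has fewer than `N` samples in `B`. -/
def underSampled {S A : Type*} [Fintype S] [DecidableEq S] [DecidableEq A] (Γ : Finset (S × A))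
    (N : ℝ) (B : Batch S A) (s : S) : Set A :=
  {a | (s, a) ∈ Γ ∧ (visitCount B s a : ℝ) < N}

open Classical in
/-- The estimated probability that action `a` in `s` leads to a state with an under-sampled pair. -/
def exploreScore {S A : Type*} [Fintype S] [DecidableEq S] [DecidableEq A] (Γ : Finset (S × A))
    (N : ℝ) (B : Batch S A) (s : S) (a : A) : ℝ :=
  ∑ s', empirical B s a s' * (if (underSampled Γ N B s').Nonempty then 1 else 0)

open Classical in
/-- The actions that `ExploreID` may return in state `s` when `B` are the samples collected so far
in the episode, that is the full `argmax` set, before ties are broken. -/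
def exploreIDActions {S A : Type*} [Fintype S] [DecidableEq S] [DecidableEq A] (Γ : Finset (S × A))
    (N : ℝ) (B : Batch S A) (s : S) : Set A :=
  if (underSampled Γ N B s).Nonempty then
    {a | a ∈ underSampled Γ N B s ∧
      ∀ b ∈ underSampled Γ N B s, visitCount B s b ≤ visitCount B s a}
  else
    {a | ∀ b, exploreScore Γ N B s b ≤ exploreScore Γ N B s a}

/-! ### The interaction of learner and adversary -/

/-- The samples and the current state after `h` steps from `s₁` in the MDP `P`, under the
history-dependent policy `π` (a function of the samples so far and of the current state). -/
def rollout {S A : Type*} (P : S → A → PMF S) (π : Batch S A → S → PMF A) (s₁ : S) :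
    ℕ → PMF (Batch S A × S)
  | 0 => PMF.pure ([], s₁)
  | h + 1 => (rollout P π s₁ h).bind fun x =>
      (π x.1 x.2).bind fun a => (P x.2 a).map fun s' => (x.1 ++ [(x.2, a, s')], s')

/-- The record of one episode: the task, the initial state, and the samples of all steps. -/
structure Episode (S A : Type*) (M : ℕ) where
  task : Fin M
  init : S
  samples : Batch S A

/-- A policy of the learner for a sequence of episodes, given the earlier episodes, the samples so
far in the current one, and the current state. Deterministic policies are point masses. -/
abbrev Policy (S A : Type*) (M : ℕ) := List (Episode S A M) → Batch S A → S → PMF A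

/-- An adaptive, possibly randomized adversary: it picks the task and the initial state of the next
episode knowing all earlier episodes. -/
abbrev Adversary (S A : Type*) (M : ℕ) := List (Episode S A M) → PMF (Fin M × S)

/-- `explore` implements `ExploreID` for `Γ` and `N`, with any rule for the remaining ties. -/
def IsExploreID {S A : Type*} [Fintype S] [DecidableEq S] [DecidableEq A] {M : ℕ}
    (Γ : Finset (S × A)) (N : ℝ) (explore : Policy S A M) : Prop :=
  ∀ past B s, ∀ a ∈ (explore past B s).support, a ∈ exploreIDActions Γ N B s

/-- Follow `explore` during the first `L` steps of the episode (clustering phase) and `learn` in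
the steps after them (learning phase). -/
def twoPhase {S A : Type*} {M : ℕ} (L : ℕ) (explore learn : Policy S A M) : Policy S A M :=
  fun past B s => if B.length < L then explore past B s else learn past B s

/-- The law of the records of the first `k` episodes, of `H` steps each. -/
def run {S A : Type*} {M : ℕ} (P : Fin M → S → A → PMF S) (H : ℕ) (adv : Adversary S A M)
    (π : Policy S A M) : ℕ → PMF (List (Episode S A M))
  | 0 => PMF.pure []
  | k + 1 => (run P H adv π k).bind fun past =>
      (adv past).bind fun c =>
        (rollout (P c.1) (π past) c.2 H).map fun x => past ++ [⟨c.1, c.2, x.1⟩]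

/-- `B_k`: the samples of the clustering phase, the first `L` steps of the episode. -/
def Episode.clustering {S A : Type*} {M : ℕ} (L : ℕ) (e : Episode S A M) : Batch S A :=
  e.samples.take L

/-! ### The parameters -/

/-- `N = (256 / lam²) max {S, ln (K |Γ| / p₁)}`, with `S` states and `g = |Γ|`. -/
def sampleTarget (lam p₁ : ℝ) (S K g : ℕ) : ℝ :=
  256 / lam ^ 2 * max (S : ℝ) (Real.log ((K : ℝ) * (g : ℝ) / p₁))

/-- `H₀ = 12 D |Γ| N`, with `g = |Γ|`. -/
def clusterHorizon (D N : ℝ) (g : ℕ) : ℝ :=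
  12 * D * (g : ℝ) * N

end MultiTaskRL

end

/-! The hitting time bounds passage times under every stationary policy, so the worst such policy
yields, for each state `t`, a function with values in `[1, 2]` whose mean shrinks by the factor `q =
1 - 1/(2D)` at each step before `t` is reached, whatever action is taken (`exists_drift`). No
estimate of the transitions is then needed.

Take as potential `4 ^ deficit` times the drift function of some state that still has an
under-sampled pair. In a state with an under-sampled pair, ExploreID lowers the deficit by one; the
factor 4 pays for the at most twofold change of the drift function and for `q ≥ 1/2`. Elsewhere the
under-sampled sets, hence the target, stay fixed and the drift applies. So the potential contracts
by `q` in mean at every step (`expect_potential_le`). It dominates the failure indicator, so an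
episode fails with probability at most `2 * 4 ^ (|Γ| * ⌈N⌉₊) * q ^ L`. A union bound over episodes
and `failure_bound` finish. -/

noncomputable section

namespace MultiTaskRL

/-! ### Expectations of nonnegative functions -/

/-- The expectation of a nonnegative function. -/
def expect {α : Type*} (p : PMF α) (f : α → ℝ≥0∞) : ℝ≥0∞ := ∑' x, p x * f x

lemma expect_pure {α : Type*} (a : α) (f : α → ℝ≥0∞) : expect (PMF.pure a) f = f a := by
  classical
  unfold expect
  rw [tsum_eq_single a]
  · simp
  · intro b hb
    simp [hb]

lemma expect_bind {α β : Type*} (p : PMF α) (g : α → PMF β) (f : β → ℝ≥0∞) :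
    expect (p.bind g) f = expect p fun a => expect (g a) f := by
  unfold expect
  simp only [PMF.bind_apply, ← ENNReal.tsum_mul_right, ← ENNReal.tsum_mul_left]
  rw [ENNReal.tsum_comm]
  simp only [mul_assoc]

lemma expect_map {α β : Type*} (p : PMF α) (g : α → β) (f : β → ℝ≥0∞) :
    expect (p.map g) f = expect p fun a => f (g a) := by
  rw [PMF.map, expect_bind]
  simp only [Function.comp_apply, expect_pure]

lemma expect_mono_support {α : Type*} (p : PMF α) {f g : α → ℝ≥0∞}
    (h : ∀ a ∈ p.support, f a ≤ g a) : expect p f ≤ expect p g := by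
  refine ENNReal.tsum_le_tsum fun a => ?_
  by_cases ha : p a = 0
  · simp [ha]
  · exact mul_le_mul_right (h a ha) _

lemma expect_mono {α : Type*} (p : PMF α) {f g : α → ℝ≥0∞} (h : ∀ a, f a ≤ g a) :
    expect p f ≤ expect p g :=
  expect_mono_support p fun a _ => h a

lemma expect_const {α : Type*} (p : PMF α) (c : ℝ≥0∞) : expect p (fun _ => c) = c := by
  unfold expect
  rw [ENNReal.tsum_mul_right, p.tsum_coe, one_mul]

lemma expect_const_mul {α : Type*} (p : PMF α) (c : ℝ≥0∞) (f : α → ℝ≥0∞) :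
    expect p (fun a => c * f a) = c * expect p f := by
  unfold expect
  rw [← ENNReal.tsum_mul_left]
  exact tsum_congr fun a => mul_left_comm _ _ _

lemma expect_add {α : Type*} (p : PMF α) (f g : α → ℝ≥0∞) :
    expect p (fun a => f a + g a) = expect p f + expect p g := by
  unfold expect
  rw [← ENNReal.tsum_add]
  exact tsum_congr fun a => mul_add _ _ _

lemma expect_le_of_support {α : Type*} (p : PMF α) {f : α → ℝ≥0∞} {c : ℝ≥0∞}
    (h : ∀ a ∈ p.support, f a ≤ c) : expect p f ≤ c :=
  (expect_mono_support p h).trans_eq (expect_const p c)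

lemma toOuterMeasure_eq_expect {α : Type*} (p : PMF α) (s : Set α) :
    p.toOuterMeasure s = expect p (s.indicator 1) := by
  rw [PMF.toOuterMeasure_apply]
  unfold expect
  refine tsum_congr fun a => ?_
  by_cases ha : a ∈ s <;> simp [ha]

lemma one_sub_le_toOuterMeasure {α : Type*} (p : PMF α) (s : Set α) {δ : ℝ≥0∞}
    (h : expect p (sᶜ.indicator 1) ≤ δ) : 1 - δ ≤ p.toOuterMeasure s := by
  rw [toOuterMeasure_eq_expect]
  refine tsub_le_iff_right.2 ?_
  calc (1 : ℝ≥0∞) = expect p (fun _ => 1) := (expect_const p 1).symm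
    _ = expect p (s.indicator 1) + expect p (sᶜ.indicator 1) := by
        rw [← expect_add]
        congr 1
        funext a
        by_cases ha : a ∈ s <;> simp [ha]
    _ ≤ _ := by gcongr

/-! ### First passage times -/

lemma sum_toReal {S : Type*} [Fintype S] (p : PMF S) : ∑ x, (p x).toReal = 1 := by
  rw [← ENNReal.toReal_sum fun x _ => p.apply_ne_top x, ← tsum_fintype (L := .unconditional S),
    p.tsum_coe, ENNReal.toReal_one]

lemma passageTail_zero {S : Type*} (κ : S → PMF S) (s t : S) : passageTail κ s t 0 = 1 := by
  unfold passageTail chainPath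
  rw [toOuterMeasure_eq_expect, expect_pure]
  simp

section Passage

variable {S : Type*} [Fintype S] [DecidableEq S]

lemma passageTail_succ (κ : S → PMF S) (s t : S) (n : ℕ) :
    passageTail κ s t (n + 1) = ∑ x, κ s x * (if x = t then 0 else passageTail κ x t n) := by
  unfold passageTail
  rw [chainPath, PMF.toOuterMeasure_bind_apply, tsum_fintype]
  refine Finset.sum_congr rfl fun x _ => ?_
  rw [PMF.toOuterMeasure_map_apply]
  congr 1
  split_ifs with h
  · subst h
    simp
  · congr 1
    ext l
    simp [Ne.symm h]

/-- First-step analysis. Working in `ℝ≥0∞` makes it valid without finiteness, and for `s = t` it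
describes the return time. -/
lemma expectedPassage_eq (κ : S → PMF S) (s t : S) :
    expectedPassage κ s t =
      1 + ∑ x, κ s x * (if x = t then 0 else expectedPassage κ x t) := by
  unfold expectedPassage
  rw [tsum_eq_zero_add' ENNReal.summable, passageTail_zero]
  congr 1
  simp only [passageTail_succ]
  rw [Summable.tsum_finsetSum fun _ _ => ENNReal.summable]
  refine Finset.sum_congr rfl fun x _ => ?_
  rw [ENNReal.tsum_mul_left]
  split_ifs <;> simp

lemma expectedPassage_le_hittingTime {S A : Type*} (P : S → A → PMF S) (π : S → A) (s t : S) :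
    expectedPassage (fun x => P x (π x)) s t ≤ hittingTime P :=
  le_iSup_of_le s (le_iSup_of_le t
    (le_iSup (fun π : S → A => expectedPassage (fun x => P x (π x)) s t) π))

/-- The mean first passage time as a real number. -/
def meanPassage (κ : S → PMF S) (t s : S) : ℝ := (expectedPassage κ s t).toReal

/-- The substochastic kernel of a chain killed at `t`, acting on functions. -/
def killed (p : PMF S) (t : S) (g : S → ℝ) : ℝ :=
  ∑ x, (p x).toReal * (if x = t then 0 else g x)

lemma killed_mono (p : PMF S) (t : S) {g h : S → ℝ} (hgh : ∀ x, g x ≤ h x) :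
    killed p t g ≤ killed p t h := by
  unfold killed
  gcongr with x
  split_ifs
  · exact le_rfl
  · exact hgh x

lemma killed_sub (p : PMF S) (t : S) (g h : S → ℝ) :
    killed p t (fun x => g x - h x) = killed p t g - killed p t h := by
  unfold killed
  rw [← Finset.sum_sub_distrib]
  refine Finset.sum_congr rfl fun x _ => ?_
  split_ifs <;> ring

lemma killed_const_mul (p : PMF S) (t : S) (c : ℝ) (g : S → ℝ) :
    killed p t (fun x => c * g x) = c * killed p t g := by
  unfold killed
  rw [Finset.mul_sum]
  refine Finset.sum_congr rfl fun x _ => ?_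
  split_ifs <;> ring

lemma meanPassage_eq (κ : S → PMF S) (t : S) (hfin : ∀ s, expectedPassage κ s t ≠ ⊤) (s : S) :
    meanPassage κ t s = 1 + killed (κ s) t (meanPassage κ t) := by
  have hne : ∀ x, κ s x * (if x = t then 0 else expectedPassage κ x t) ≠ ⊤ := fun x => by
    refine ENNReal.mul_ne_top ((κ s).apply_ne_top x) ?_
    split_ifs
    · exact ENNReal.zero_ne_top
    · exact hfin x
  unfold meanPassage killed
  rw [expectedPassage_eq, ENNReal.toReal_add ENNReal.one_ne_top
    (ENNReal.sum_ne_top.2 fun x _ => hne x), ENNReal.toReal_one,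
    ENNReal.toReal_sum fun x _ => hne x]
  congr 1
  refine Finset.sum_congr rfl fun x _ => ?_
  rw [ENNReal.toReal_mul]
  split_ifs <;> simp

/-- A subharmonic function of the killed chain is nonpositive. -/
lemma nonpos_of_le_killed (κ : S → PMF S) (t : S) (hfin : ∀ s, expectedPassage κ s t ≠ ⊤)
    (d : S → ℝ) (hd : ∀ s, d s ≤ killed (κ s) t d) (s : S) : d s ≤ 0 := by
  obtain ⟨c, hc⟩ : ∃ c, ∀ x, d x ≤ c := by
    obtain ⟨c, hc⟩ := (Set.finite_range d).bddAbove
    exact ⟨c, fun x => hc ⟨x, rfl⟩⟩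
  have htop : ∀ n x, passageTail κ x t n ≠ ⊤ := fun n x =>
    ne_top_of_le_ne_top (hfin x) (ENNReal.le_tsum n)
  -- Iterating `hd` leaves only the mass that has avoided `t` for `n` steps; these tails are
  -- summable, so they tend to 0.
  have key : ∀ n x, d x ≤ c * (passageTail κ x t n).toReal := by
    intro n
    induction n with
    | zero => intro x; simpa [passageTail_zero] using hc x
    | succ n ih =>
      intro x
      refine (hd x).trans ((killed_mono _ _ ih).trans_eq ?_)
      rw [killed_const_mul, passageTail_succ, ENNReal.toReal_sum]
      · unfold killed
        congr 1
        refine Finset.sum_congr rfl fun y _ => ?_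
        rw [ENNReal.toReal_mul]
        split_ifs <;> simp
      · intro y _
        refine ENNReal.mul_ne_top ((κ x).apply_ne_top y) ?_
        split_ifs
        · exact ENNReal.zero_ne_top
        · exact htop n y
  have hlim : Filter.Tendsto (fun n => c * (passageTail κ s t n).toReal) Filter.atTop
      (nhds (c * 0)) := by
    refine Filter.Tendsto.const_mul c ?_
    have := (ENNReal.tendsto_toReal ENNReal.zero_ne_top).comp
      (ENNReal.tendsto_atTop_zero_of_tsum_ne_top (hfin s))
    simpa [Function.comp_def] using this
  rw [mul_zero] at hlim
  exact ge_of_tendsto' hlim fun n => key n s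

/-- Policy improvement: a bound on the mean passage times to `t` under all stationary policies
gives a bounded solution of the optimality inequality. -/
lemma exists_supersolution {A : Type*} [Finite A] [Nonempty A] (P : S → A → PMF S) (D : ℝ)
    (hD0 : 0 ≤ D) (hD : hittingTime P ≤ ENNReal.ofReal D) (t : S) :
    ∃ e : S → ℝ, (∀ s, 1 ≤ e s) ∧ (∀ s, e s ≤ D) ∧ ∀ s a, 1 + killed (P s a) t e ≤ e s := by
  classical
  have hle : ∀ (π : S → A) s, expectedPassage (fun x => P x (π x)) s t ≤ ENNReal.ofReal D :=
    fun π s => (expectedPassage_le_hittingTime P π s t).trans hD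
  have hfin : ∀ (π : S → A) s, expectedPassage (fun x => P x (π x)) s t ≠ ⊤ := fun π s =>
    ne_top_of_le_ne_top ENNReal.ofReal_ne_top (hle π s)
  let e : (S → A) → S → ℝ := fun π => meanPassage (fun x => P x (π x)) t
  have he : ∀ π s, e π s = 1 + killed (P s (π s)) t (e π) := fun π s =>
    meanPassage_eq _ t (hfin π) s
  have he0 : ∀ π s, 0 ≤ e π s := fun π s => ENNReal.toReal_nonneg
  -- Maximizing the sum over states suffices: an improving switch at one state lowers the passage
  -- time from no state and strictly raises one.
  obtain ⟨π, hπ⟩ := Finite.exists_max fun π : S → A => ∑ s, e π s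
  refine ⟨e π, fun s => ?_, fun s => ENNReal.toReal_le_of_le_ofReal hD0 (hle π s), ?_⟩
  · rw [he π s]
    refine le_add_of_nonneg_right (Finset.sum_nonneg fun x _ => ?_)
    refine mul_nonneg ENNReal.toReal_nonneg ?_
    split_ifs
    · exact le_rfl
    · exact he0 π x
  · intro s a
    by_contra! hlt
    let π' : S → A := Function.update π s a
    have hle' : ∀ x, e π x ≤ 1 + killed (P x (π' x)) t (e π) := by
      intro x
      by_cases hx : x = s
      · subst hx
        simpa [π'] using hlt.le
      · have : π' x = π x := Function.update_of_ne hx _ _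
        rw [this]
        exact (he π x).le
    -- The difference `e π - e π'` is subharmonic for the killed chain of `π'`.
    have hcomp : ∀ x, e π x ≤ e π' x := by
      intro x
      have := nonpos_of_le_killed (fun x => P x (π' x)) t (hfin π') (fun x => e π x - e π' x)
        (fun y => by
          rw [killed_sub]
          have h1 := hle' y
          have h2 := he π' y
          linarith) x
      linarith
    have hs : e π s < e π' s := by
      rw [he π' s]
      have : π' s = a := Function.update_self _ _ _
      rw [this]
      have := killed_mono (P s a) t hcomp
      linarith
    exact absurd (hπ π') (not_le.2 (Finset.sum_lt_sum (fun x _ => hcomp x) ⟨s, Finset.mem_univ s, hs⟩))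

/-- A bounded function that decreases geometrically in the mean until `t` is reached. -/
lemma exists_drift {A : Type*} [Finite A] [Nonempty A] (P : S → A → PMF S) (D : ℝ)
    (hD1 : 1 ≤ D) (hD : hittingTime P ≤ ENNReal.ofReal D) (t : S) :
    ∃ f : S → ℝ≥0∞, (∀ s, 1 ≤ f s) ∧ (∀ s, f s ≤ 2) ∧
      ∀ s a, s ≠ t → expect (P s a) f ≤ ENNReal.ofReal (1 - 1 / (2 * D)) * f s := by
  have hD0 : 0 < D := by linarith
  obtain ⟨e, he1, heD, he⟩ := exists_supersolution P D hD0.le hD t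
  -- `e t` is a bound on return times; resetting it to 0 at `t` turns the killed kernel into a plain
  -- expectation. The drift function is `1 + v / D`.
  let v : S → ℝ := fun s => if s = t then 0 else e s
  have hv0 : ∀ s, 0 ≤ v s := fun s => by
    dsimp only [v]
    split_ifs
    · exact le_rfl
    · linarith [he1 s]
  have hvD : ∀ s, v s ≤ D := fun s => by
    dsimp only [v]
    split_ifs
    · exact hD0.le
    · exact heD s
  have hvd0 : ∀ s, 0 ≤ v s / D := fun s => div_nonneg (hv0 s) hD0.le
  have hvd1 : ∀ s, v s / D ≤ 1 := fun s => (div_le_one hD0).2 (hvD s)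
  refine ⟨fun s => ENNReal.ofReal (1 + v s / D), fun s => ?_, fun s => ?_, fun s a hs => ?_⟩
  · rw [ENNReal.one_le_ofReal]
    linarith [hvd0 s]
  · refine ENNReal.ofReal_le_of_le_toReal ?_
    rw [ENNReal.toReal_ofNat]
    linarith [hvd1 s]
  · have hq : 0 ≤ 1 - 1 / (2 * D) := by
      rw [sub_nonneg, div_le_one (by linarith)]
      linarith
    rw [← ENNReal.ofReal_mul hq]
    unfold expect
    rw [tsum_fintype]
    have hterm : ∀ x, P s a x * ENNReal.ofReal (1 + v x / D) =
        ENNReal.ofReal ((P s a x).toReal * (1 + v x / D)) := fun x => by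
      rw [ENNReal.ofReal_mul ENNReal.toReal_nonneg, ENNReal.ofReal_toReal ((P s a).apply_ne_top x)]
    simp only [hterm]
    rw [← ENNReal.ofReal_sum_of_nonneg fun x _ =>
      mul_nonneg ENNReal.toReal_nonneg (by linarith [hvd0 x])]
    refine ENNReal.ofReal_le_ofReal ?_
    have hsum : ∑ x, (P s a x).toReal * (1 + v x / D) = 1 + killed (P s a) t e / D := by
      simp only [mul_add, mul_one, Finset.sum_add_distrib, sum_toReal]
      unfold killed
      rw [Finset.sum_div]
      simp only [v, mul_div_assoc]
    rw [hsum]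
    have h1 := he s a
    have h2 : v s = e s := if_neg hs
    have h3 := hvd1 s
    have h4 : killed (P s a) t e / D ≤ (v s - 1) / D := by
      rw [h2]
      gcongr
      linarith
    rw [sub_div] at h4
    -- The additive decrease `1 / D` is at least the fraction `1 / (2D)` of the current value, since
    -- that value is at most 2.
    have h5 : 1 / (2 * D) * (1 + v s / D) ≤ 1 / (2 * D) * 2 := by
      gcongr
      linarith
    have h6 : 1 / (2 * D) * 2 = 1 / D := by field_simp
    linarith

end Passage

lemma one_le_of_hittingTime_le {S A : Type*} [Fintype S] [DecidableEq S] [Nonempty S] [Nonempty A]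
    (P : S → A → PMF S) (D : ℝ) (hD : hittingTime P ≤ ENNReal.ofReal D) : 1 ≤ D := by
  obtain ⟨s⟩ := ‹Nonempty S›
  obtain ⟨a⟩ := ‹Nonempty A›
  rw [← ENNReal.one_le_ofReal]
  refine le_trans ?_ ((expectedPassage_le_hittingTime P (fun _ => a) s s).trans hD)
  rw [expectedPassage_eq]
  exact le_self_add

/-! ### Remaining visits -/

section Deficit

variable {S A : Type*} [Fintype S] [DecidableEq S] [DecidableEq A]

lemma visitCount_append (B : Batch S A) (s : S) (a : A) (s' : S) (x : S × A) :
    visitCount (B ++ [(s, a, s')]) x.1 x.2 =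
      visitCount B x.1 x.2 + if x = (s, a) then 1 else 0 := by
  unfold visitCount transitionCount
  simp only [List.count_append, Finset.sum_add_distrib, List.count_singleton]
  congr 1
  obtain ⟨u, b⟩ := x
  by_cases h : (u, b) = (s, a)
  · obtain ⟨rfl, rfl⟩ := Prod.mk.inj h
    simp [Finset.sum_ite_eq]
  · rw [if_neg h]
    refine Finset.sum_eq_zero fun y _ => ?_
    have : ¬ (s = u ∧ a = b) := fun ⟨h1, h2⟩ => h (by rw [h1, h2])
    simp only [beq_iff_eq, Prod.mk.injEq, ite_eq_right_iff]
    intro h'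
    exact absurd ⟨h'.1, h'.2.1⟩ this

/-- The number of visits still missing at the pairs of `Γ`. -/
def deficit (Γ : Finset (S × A)) (n : ℕ) (B : Batch S A) : ℕ :=
  ∑ x ∈ Γ, (n - visitCount B x.1 x.2)

lemma mem_underSampled_iff (Γ : Finset (S × A)) (N : ℝ) (B : Batch S A) (s : S) (a : A) :
    a ∈ underSampled Γ N B s ↔ (s, a) ∈ Γ ∧ visitCount B s a < ⌈N⌉₊ := by
  unfold underSampled
  rw [Set.mem_ofPred_eq, Nat.lt_ceil]

lemma deficit_eq_zero_iff (Γ : Finset (S × A)) (N : ℝ) (B : Batch S A) :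
    deficit Γ ⌈N⌉₊ B = 0 ↔ ∀ x ∈ Γ, N ≤ (visitCount B x.1 x.2 : ℝ) := by
  unfold deficit
  rw [Finset.sum_eq_zero_iff]
  refine forall₂_congr fun x _ => ?_
  rw [Nat.sub_eq_zero_iff_le, Nat.ceil_le]

lemma exists_underSampled (Γ : Finset (S × A)) (N : ℝ) (B : Batch S A)
    (h : deficit Γ ⌈N⌉₊ B ≠ 0) : ∃ s, (underSampled Γ N B s).Nonempty := by
  rw [Ne, deficit_eq_zero_iff] at h
  push Not at h
  obtain ⟨x, hx, hlt⟩ := h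
  exact ⟨x.1, x.2, hx, hlt⟩

lemma deficit_append_of_mem (Γ : Finset (S × A)) (N : ℝ) (B : Batch S A) (s : S) (a : A) (s' : S)
    (ha : a ∈ underSampled Γ N B s) :
    deficit Γ ⌈N⌉₊ (B ++ [(s, a, s')]) + 1 = deficit Γ ⌈N⌉₊ B := by
  obtain ⟨hΓ, hlt⟩ := (mem_underSampled_iff Γ N B s a).1 ha
  unfold deficit
  rw [← Finset.add_sum_erase _ _ hΓ, ← Finset.add_sum_erase Γ (fun x => _ - visitCount B x.1 x.2) hΓ,
    visitCount_append B s a s' (s, a), if_pos rfl]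
  have : ∑ x ∈ Γ.erase (s, a), (⌈N⌉₊ - visitCount (B ++ [(s, a, s')]) x.1 x.2) =
      ∑ x ∈ Γ.erase (s, a), (⌈N⌉₊ - visitCount B x.1 x.2) :=
    Finset.sum_congr rfl fun x hx => by
      rw [visitCount_append, if_neg (Finset.ne_of_mem_erase hx), add_zero]
  rw [this]
  dsimp only
  omega

/-- A visit to a pair outside `Γ` or already sampled enough changes no membership. Equality of the
whole function `underSampled` is what keeps the target fixed. -/
lemma underSampled_append_of_notMem (Γ : Finset (S × A)) (N : ℝ) (B : Batch S A) (s : S) (a : A)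
    (s' : S) (ha : a ∉ underSampled Γ N B s) :
    underSampled Γ N (B ++ [(s, a, s')]) = underSampled Γ N B := by
  funext u
  ext b
  rw [mem_underSampled_iff] at ha
  rw [mem_underSampled_iff, mem_underSampled_iff, visitCount_append B s a s' (u, b)]
  split_ifs with h
  · obtain ⟨rfl, rfl⟩ := Prod.mk.inj h
    dsimp only
    constructor
    · rintro ⟨h1, h2⟩
      exact ⟨h1, by omega⟩
    · intro h1
      exact absurd h1 ha
  · rfl

lemma deficit_append_of_notMem (Γ : Finset (S × A)) (N : ℝ) (B : Batch S A) (s : S) (a : A)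
    (s' : S) (ha : a ∉ underSampled Γ N B s) :
    deficit Γ ⌈N⌉₊ (B ++ [(s, a, s')]) = deficit Γ ⌈N⌉₊ B := by
  unfold deficit
  refine Finset.sum_congr rfl fun x hx => ?_
  rw [visitCount_append]
  split_ifs with h
  · subst h
    rw [mem_underSampled_iff] at ha
    have : ¬ visitCount B s a < ⌈N⌉₊ := fun h' => ha ⟨hx, h'⟩
    dsimp only
    omega
  · rfl

end Deficit

/-! ### The potential of one episode -/

section Potential

variable {S A : Type*} [Fintype S] [DecidableEq S] [DecidableEq A]

open Classical in
/-- A state with an under-sampled pair, if there is one (it depends only on the under-sampled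
pairs), and otherwise the default value `s₀`. -/
def target {S A : Type*} (s₀ : S) (U : S → Set A) : S :=
  if h : ∃ s, (U s).Nonempty then h.choose else s₀

lemma target_spec {S A : Type*} (s₀ : S) (U : S → Set A) (h : ∃ s, (U s).Nonempty) :
    (U (target s₀ U)).Nonempty := by
  unfold target
  rw [dif_pos h]
  exact h.choose_spec

/-- The potential of a batch `B` and a current state, for drift functions `f`. -/
def potential (f : S → S → ℝ≥0∞) (s₀ : S) (Γ : Finset (S × A)) (N : ℝ) (x : Batch S A × S) :
    ℝ≥0∞ :=
  if deficit Γ ⌈N⌉₊ x.1 = 0 then 0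
  else 4 ^ deficit Γ ⌈N⌉₊ x.1 * f (target s₀ (underSampled Γ N x.1)) x.2

lemma potential_le (f : S → S → ℝ≥0∞) (hf : ∀ t s, f t s ≤ 2) (s₀ : S) (Γ : Finset (S × A))
    (N : ℝ) (x : Batch S A × S) : potential f s₀ Γ N x ≤ 4 ^ deficit Γ ⌈N⌉₊ x.1 * 2 := by
  unfold potential
  split_ifs
  · exact zero_le
  · exact mul_le_mul_right (hf _ _) _

/-- The potential contracts in the mean at each step of `ExploreID`. -/
lemma expect_potential_le (P : S → A → PMF S) (f : S → S → ℝ≥0∞) (q : ℝ≥0∞) (hq : 2 ≤ 4 * q)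
    (hf1 : ∀ t s, 1 ≤ f t s) (hf2 : ∀ t s, f t s ≤ 2)
    (hdrift : ∀ t s a, s ≠ t → expect (P s a) (f t) ≤ q * f t s)
    (s₀ : S) (Γ : Finset (S × A)) (N : ℝ) (B : Batch S A) (s : S) (a : A)
    (ha : a ∈ exploreIDActions Γ N B s) :
    expect (P s a) (fun s' => potential f s₀ Γ N (B ++ [(s, a, s')], s')) ≤
      q * potential f s₀ Γ N (B, s) := by
  by_cases hU : (underSampled Γ N B s).Nonempty
  · rw [exploreIDActions, if_pos hU] at ha
    have hmem := ha.1
    have hr := fun s' => deficit_append_of_mem Γ N B s a s' hmem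
    have hpos : deficit Γ ⌈N⌉₊ B ≠ 0 := by
      rw [← hr s]
      omega
    -- The target may change here, so the new drift value is bounded by 2 and the old one by 1 from
    -- below.
    refine expect_le_of_support _ fun s' _ => (potential_le f hf2 s₀ Γ N _).trans ?_
    rw [potential, if_neg hpos]
    dsimp only
    rw [← hr s', pow_succ]
    set m := deficit Γ ⌈N⌉₊ (B ++ [(s, a, s')])
    calc (4 : ℝ≥0∞) ^ m * 2 ≤ 4 ^ m * (4 * q) * 1 := by
          rw [mul_one]
          gcongr
      _ ≤ 4 ^ m * (4 * q) * f (target s₀ (underSampled Γ N B)) s := by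
          gcongr
          exact hf1 _ _
      _ = _ := by ring
  · have hnot : a ∉ underSampled Γ N B s := fun h => hU ⟨a, h⟩
    simp only [potential, deficit_append_of_notMem Γ N B s a _ hnot,
      underSampled_append_of_notMem Γ N B s a _ hnot]
    split_ifs with h0
    · rw [expect_const]
      exact zero_le
    · rw [expect_const_mul, mul_left_comm]
      refine mul_le_mul_right (hdrift _ _ _ ?_) _
      -- The target has an under-sampled pair and the current state has none.
      intro hs
      have := target_spec s₀ (underSampled Γ N B) (exists_underSampled Γ N B h0)
      rw [← hs] at this
      exact hU this

lemma length_of_mem_support_rollout {S A : Type*} (P : S → A → PMF S) (π : Batch S A → S → PMF A)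
    (s₁ : S) (h : ℕ) : ∀ x ∈ (rollout P π s₁ h).support, x.1.length = h := by
  induction h with
  | zero =>
    intro x hx
    simp only [rollout, PMF.support_pure, Set.mem_singleton_iff] at hx
    simp [hx]
  | succ h ih =>
    intro x hx
    simp only [rollout, PMF.mem_support_bind_iff, PMF.mem_support_map_iff] at hx
    obtain ⟨y, hy, a, -, s', -, rfl⟩ := hx
    simp [ih y hy]

/-- A function that does not increase in the mean along each step does not increase in the mean
along a rollout. -/
lemma expect_rollout_le {S A : Type*} (P : S → A → PMF S) (π : Batch S A → S → PMF A) (s₁ : S)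
    (Ψ : Batch S A × S → ℝ≥0∞)
    (hstep : ∀ B s, ∀ a ∈ (π B s).support,
      expect (P s a) (fun s' => Ψ (B ++ [(s, a, s')], s')) ≤ Ψ (B, s)) (h : ℕ) :
    expect (rollout P π s₁ h) Ψ ≤ Ψ ([], s₁) := by
  induction h with
  | zero => rw [rollout, expect_pure]
  | succ h ih =>
    rw [rollout, expect_bind]
    refine (expect_mono _ fun x => ?_).trans ih
    rw [expect_bind]
    refine expect_le_of_support _ fun a ha => ?_
    rw [expect_map]
    exact hstep x.1 x.2 a ha

/-- The failure probability of the clustering phase of one episode. -/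
lemma expect_rollout_bad_le (P : S → A → PMF S) (f : S → S → ℝ≥0∞) (q : ℝ≥0∞)
    (hq : 2 ≤ 4 * q) (hf1 : ∀ t s, 1 ≤ f t s) (hf2 : ∀ t s, f t s ≤ 2)
    (hdrift : ∀ t s a, s ≠ t → expect (P s a) (f t) ≤ q * f t s)
    (Γ : Finset (S × A)) (N : ℝ) (L H : ℕ) (hLH : L ≤ H) (π : Batch S A → S → PMF A)
    (hπ : ∀ B s, B.length < L → ∀ a ∈ (π B s).support, a ∈ exploreIDActions Γ N B s) (s₁ : S) :
    expect (rollout P π s₁ H) (fun x => if deficit Γ ⌈N⌉₊ (x.1.take L) = 0 then 0 else 1) ≤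
      q ^ L * (4 ^ (Γ.card * ⌈N⌉₊) * 2) := by
  have hbad : ∀ x : Batch S A × S,
      (if deficit Γ ⌈N⌉₊ x.1 = 0 then 0 else 1) ≤ potential f s₁ Γ N x := by
    intro x
    unfold potential
    split_ifs
    · exact le_rfl
    · exact one_le_mul (one_le_pow₀ (by norm_num)) (hf1 _ _)
  -- A supermartingale for the whole episode: the potential discounted by the remaining clustering
  -- steps, then the failure indicator, frozen after step `L`.
  let Ψ : Batch S A × S → ℝ≥0∞ := fun x =>
    if x.1.length ≤ L then q ^ (L - x.1.length) * potential f s₁ Γ N x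
    else if deficit Γ ⌈N⌉₊ (x.1.take L) = 0 then 0 else 1
  have hstep : ∀ B s, ∀ a ∈ (π B s).support,
      expect (P s a) (fun s' => Ψ (B ++ [(s, a, s')], s')) ≤ Ψ (B, s) := by
    intro B s a ha
    rcases lt_trichotomy B.length L with hlt | heq | hgt
    · have h1 : ∀ s', Ψ (B ++ [(s, a, s')], s') =
          q ^ (L - (B.length + 1)) * potential f s₁ Γ N (B ++ [(s, a, s')], s') := fun s' => by
        have : (B ++ [(s, a, s')]).length = B.length + 1 := by simp
        simp only [Ψ, this, if_pos (Nat.succ_le_of_lt hlt)]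
      have h2 : Ψ (B, s) = q ^ (L - (B.length + 1)) * (q * potential f s₁ Γ N (B, s)) := by
        simp only [Ψ, if_pos hlt.le]
        rw [← mul_assoc, ← pow_succ]
        congr 2
        omega
      simp only [h1, h2, expect_const_mul]
      exact mul_le_mul_right (expect_potential_le P f q hq hf1 hf2 hdrift s₁ Γ N B s a
        (hπ B s hlt a ha)) _
    -- Sample `L + 1` is dropped by `take L`, so the potential only has to dominate the indicator at
    -- `B` itself.
    · refine expect_le_of_support _ fun s' _ => ?_
      have h1 : (B ++ [(s, a, s')]).take L = B := by simp [← heq]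
      have h2 : ¬ (B ++ [(s, a, s')]).length ≤ L := by simp [← heq]
      simp only [Ψ, if_neg h2, h1, if_pos heq.le, heq, Nat.sub_self, pow_zero, one_mul]
      exact hbad (B, s)
    · refine expect_le_of_support _ fun s' _ => ?_
      have h1 : (B ++ [(s, a, s')]).take L = B.take L := List.take_append_of_le_length hgt.le
      have h2 : ¬ (B ++ [(s, a, s')]).length ≤ L := by
        simp only [List.length_append, List.length_singleton]
        omega
      simp only [Ψ, if_neg h2, h1, if_neg (not_le.2 hgt), le_refl]
  refine (expect_mono_support _ fun x hx => ?_).trans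
    ((expect_rollout_le P π s₁ Ψ hstep H).trans ?_)
  · have hlen := length_of_mem_support_rollout P π s₁ H x hx
    by_cases hL : x.1.length ≤ L
    · have hxL : x.1.length = L := by omega
      have h1 : x.1.take L = x.1 := List.take_of_length_le hL
      simp only [Ψ, if_pos hL, h1, hxL, Nat.sub_self, pow_zero, one_mul]
      exact hbad x
    · simp only [Ψ, if_neg hL, le_refl]
  · simp only [Ψ, List.length_nil, Nat.zero_le, if_true, Nat.sub_zero]
    refine mul_le_mul_right ((potential_le f hf2 s₁ Γ N _).trans_eq ?_) _
    simp [deficit, visitCount, transitionCount]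

end Potential

/-! ### All episodes -/

/-- If each episode fails with probability at most `δ` whatever happened before, then the
probability that one of the first `k` episodes fails is at most `k * δ`. -/
lemma expect_run_bad_le {S A : Type*} {M : ℕ} (P : Fin M → S → A → PMF S) (H : ℕ)
    (adv : Adversary S A M) (π : Policy S A M) (good : Batch S A → Prop) (δ : ℝ≥0∞)
    (hδ : ∀ past i s, expect (rollout (P i) (π past) s H)
      ({x | ¬ good x.1}.indicator 1) ≤ δ) (k : ℕ) :
    expect (run P H adv π k)
      ({past | past.length = k ∧ ∀ e ∈ past, good e.samples}ᶜ.indicator 1) ≤ k * δ := by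
  induction k with
  | zero => simp [run, expect_pure]
  | succ k ih =>
    rw [run, expect_bind]
    calc _ ≤ expect (run P H adv π k) (fun past =>
          {past : List (Episode S A M) |
            past.length = k ∧ ∀ e ∈ past, good e.samples}ᶜ.indicator 1 past + δ) := by
          refine expect_mono _ fun past => ?_
          rw [expect_bind]
          refine expect_le_of_support _ fun c _ => ?_
          rw [expect_map]
          -- After a good past only the new episode can fail; after a bad one the bound 1 is already
          -- paid by the indicator.
          by_cases hp : past.length = k ∧ ∀ e ∈ past, good e.samples
          · refine le_trans (expect_mono _ fun x => ?_) ((hδ past c.1 c.2).trans le_add_self)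
            by_cases hx : good x.1
            · rw [Set.indicator_of_notMem]
              · exact zero_le
              · rw [Set.mem_compl_iff, not_not]
                refine ⟨by simp [hp.1], fun e he => ?_⟩
                rcases List.mem_append.1 he with he | he
                · exact hp.2 e he
                · rw [List.mem_singleton.1 he]
                  exact hx
            · rw [Set.indicator_of_mem (show x ∈ {x : Batch S A × S | ¬ good x.1} from hx)]
              exact Set.indicator_le_self' (fun _ _ => zero_le) _
          · rw [Set.indicator_of_mem (show past ∈ _ from hp)]
            refine le_trans (expect_le_of_support _ (c := 1) fun x _ => ?_) le_self_add
            exact Set.indicator_le_self' (fun _ _ => zero_le) _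
      _ ≤ k * δ + δ := by
          rw [expect_add, expect_const]
          gcongr
      _ = _ := by
          push_cast
          ring

/-! ### The numerical bound -/

lemma failure_bound (D N p : ℝ) (g S K L : ℕ) (lam : ℝ) (hlam : 0 < lam) (hlam2 : lam ≤ 2)
    (hp₀ : 0 < p) (hp₁ : p < 1) (hD : 1 ≤ D) (hg : 1 ≤ g) (hS : 1 ≤ S) (hK : 1 ≤ K)
    (hN : N = sampleTarget lam p S K g) (hL : L = ⌊clusterHorizon D N g⌋₊) :
    (K : ℝ) * ((1 - 1 / (2 * D)) ^ L * (4 ^ (g * ⌈N⌉₊) * 2)) ≤ p := by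
  have hgR : (1 : ℝ) ≤ g := by exact_mod_cast hg
  have hSR : (1 : ℝ) ≤ S := by exact_mod_cast hS
  have hKR : (1 : ℝ) ≤ K := by exact_mod_cast hK
  set l := Real.log ((K : ℝ) * g / p) with hl
  -- With `lam ≤ 2` this gives `N ≥ 64`, so rounding `N` up costs at most the factor 65/64.
  have hcoef : 64 ≤ 256 / lam ^ 2 := by
    rw [le_div_iff₀ (by positivity)]
    nlinarith
  have hm1 : (1 : ℝ) ≤ max (S : ℝ) l := hSR.trans (le_max_left _ _)
  have hN64 : 64 * max (S : ℝ) l ≤ N := by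
    rw [hN, sampleTarget]
    exact mul_le_mul_of_nonneg_right hcoef (by linarith)
  have hN1 : 64 ≤ N := by linarith
  have hNl : l ≤ N := by
    have := le_max_right (S : ℝ) l
    linarith
  have hgN : N ≤ g * N := by nlinarith
  have hceil : (⌈N⌉₊ : ℝ) ≤ 65 / 64 * N := by
    have := Nat.ceil_lt_add_one (show 0 ≤ N by linarith)
    linarith
  have hLlow : 12 * D * g * N - 1 ≤ L := by
    have := Nat.lt_floor_add_one (clusterHorizon D N g)
    rw [hL]
    rw [clusterHorizon] at *
    linarith
  have hq0 : 0 ≤ 1 - 1 / (2 * D) := by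
    rw [sub_nonneg, div_le_one (by linarith)]
    linarith
  -- The 12 in the horizon gives decay `6gN`, with `1/2` lost to the floor; the initial potential
  -- costs at most `3gN + 1`. The surplus `3gN - 3/2` exceeds `l`.
  have h1 : (1 - 1 / (2 * D)) ^ L ≤ Real.exp (-(6 * (g * N)) + 1 / 2) := by
    calc (1 - 1 / (2 * D)) ^ L ≤ Real.exp (-(1 / (2 * D))) ^ L :=
          pow_le_pow_left₀ hq0 (by linarith [Real.add_one_le_exp (-(1 / (2 * D)))]) _
      _ = Real.exp (L * -(1 / (2 * D))) := (Real.exp_nat_mul _ _).symm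
      _ ≤ _ := by
          refine Real.exp_le_exp.2 ?_
          have h2 : (12 * D * g * N - 1) * (1 / (2 * D)) ≤ L * (1 / (2 * D)) := by gcongr
          have h3 : (12 * D * g * N - 1) * (1 / (2 * D)) = 6 * (g * N) - 1 / (2 * D) := by
            field_simp
            ring
          have h4 : 1 / (2 * D) ≤ 1 / 2 := one_div_le_one_div_of_le (by norm_num) (by linarith)
          linarith
  have h4exp : (4 : ℝ) ≤ Real.exp 2 := by
    have := Real.quadratic_le_exp_of_nonneg (show (0 : ℝ) ≤ 2 by norm_num)
    linarith
  have h2 : (4 : ℝ) ^ (g * ⌈N⌉₊) ≤ Real.exp (3 * (g * N)) := by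
    calc (4 : ℝ) ^ (g * ⌈N⌉₊) ≤ Real.exp 2 ^ (g * ⌈N⌉₊) := pow_le_pow_left₀ (by norm_num) h4exp _
      _ = Real.exp (((g * ⌈N⌉₊ : ℕ) : ℝ) * 2) := (Real.exp_nat_mul _ _).symm
      _ ≤ _ := by
          refine Real.exp_le_exp.2 ?_
          push_cast
          have : (g : ℝ) * ⌈N⌉₊ ≤ g * (65 / 64 * N) := by gcongr
          linarith
  have h2exp : (2 : ℝ) ≤ Real.exp 1 := by linarith [Real.add_one_le_exp (1 : ℝ)]
  have hKg : 0 < (K : ℝ) * g / p := by positivity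
  calc (K : ℝ) * ((1 - 1 / (2 * D)) ^ L * (4 ^ (g * ⌈N⌉₊) * 2))
      ≤ K * (Real.exp (-(6 * (g * N)) + 1 / 2) * (Real.exp (3 * (g * N)) * Real.exp 1)) := by
        gcongr
    _ = K * Real.exp (-(3 * (g * N)) + 3 / 2) := by
        rw [← Real.exp_add, ← Real.exp_add]
        ring_nf
    _ ≤ K * Real.exp (-l) := by
        gcongr
        linarith
    _ = p / g := by
        rw [Real.exp_neg, hl, Real.exp_log hKg]
        field_simp
    _ ≤ p := div_le_self hp₀.le hgR

end MultiTaskRL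

end

/-! ### Assembly of the main theorem -/

theorem mainTheorem10 {S A : Type*} [Fintype S] [DecidableEq S] [Fintype A] [DecidableEq A]
    {M : ℕ} (P : Fin M → S → A → PMF S)
    (lam α D p₁ : ℝ) (hlam : 0 < lam) (hlam2 : lam ≤ 2) (hp₀ : 0 < p₁) (hp₁ : p₁ < 1)
    (hsep : MultiTaskRL.IsSeparable P lam)
    (hD : ∀ i, MultiTaskRL.hittingTime (P i) ≤ ENNReal.ofReal D)
    (Γ : Finset (S × A)) (hΓ : MultiTaskRL.IsDistinguishingSet P α Γ)
    (K H : ℕ) (N H₀ : ℝ)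
    (hN : N = MultiTaskRL.sampleTarget lam p₁ (Fintype.card S) K Γ.card)
    (hH₀ : H₀ = MultiTaskRL.clusterHorizon D N Γ.card)
    (hH : H₀ ≤ (H : ℝ))
    (adv : MultiTaskRL.Adversary S A M) (explore learn : MultiTaskRL.Policy S A M)
    (hexplore : MultiTaskRL.IsExploreID Γ N explore) :
    H₀ = 3072 * D * (Γ.card : ℝ) / lam ^ 2 *
        max (Fintype.card S : ℝ) (Real.log ((K : ℝ) * (Γ.card : ℝ) / p₁)) ∧
    ENNReal.ofReal (1 - p₁) ≤
      (MultiTaskRL.run P H adv (MultiTaskRL.twoPhase ⌊H₀⌋₊ explore learn) K).toOuterMeasure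
        {past | past.length = K ∧ ∀ e ∈ past, ∀ x ∈ Γ,
          N ≤ (MultiTaskRL.visitCount (e.clustering ⌊H₀⌋₊) x.1 x.2 : ℝ)} := by
  have hH₀' : H₀ = 3072 * D * (Γ.card : ℝ) / lam ^ 2 *
      max (Fintype.card S : ℝ) (Real.log ((K : ℝ) * (Γ.card : ℝ) / p₁)) := by
    rw [hH₀, hN, MultiTaskRL.clusterHorizon, MultiTaskRL.sampleTarget]
    ring
  refine ⟨hH₀', ?_⟩
  rw [ENNReal.ofReal_sub _ hp₀.le, ENNReal.ofReal_one]
  refine MultiTaskRL.one_sub_le_toOuterMeasure _ _ ?_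
  -- For empty `Γ` nothing can fail; otherwise `Γ` supplies a state and an action, which `1 ≤ D`
  -- requires.
  rcases Γ.eq_empty_or_nonempty with hΓ0 | hΓne
  · refine (MultiTaskRL.expect_run_bad_le P H adv _ (fun B => ∀ x ∈ Γ,
      N ≤ (MultiTaskRL.visitCount (B.take ⌊H₀⌋₊) x.1 x.2 : ℝ)) 0 (fun past i s => ?_) K).trans
      (by simp)
    simp [hΓ0, MultiTaskRL.expect]
  rcases Nat.eq_zero_or_pos K with rfl | hK
  · simp [MultiTaskRL.run, MultiTaskRL.expect_pure]
  obtain ⟨x₀, hx₀⟩ := hΓne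
  have : Nonempty S := ⟨x₀.1⟩
  have : Nonempty A := ⟨x₀.2⟩
  -- The adversary's law has nonempty support, so some task exists and its hitting time forces `1 ≤
  -- D`.
  obtain ⟨c₀, -⟩ := (adv []).support_nonempty
  have hD1 : 1 ≤ D := MultiTaskRL.one_le_of_hittingTime_le (P c₀.1) D (hD c₀.1)
  have hq : 1 / 2 ≤ 1 - 1 / (2 * D) := by
    have := one_div_le_one_div_of_le (show (0 : ℝ) < 2 by norm_num)
      (show 2 ≤ 2 * D by linarith)
    linarith
  have hq4 : (2 : ENNReal) ≤ 4 * ENNReal.ofReal (1 - 1 / (2 * D)) := by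
    rw [show (4 : ENNReal) = ENNReal.ofReal 4 by simp, ← ENNReal.ofReal_mul (by norm_num),
      show (2 : ENNReal) = ENNReal.ofReal 2 by simp]
    exact ENNReal.ofReal_le_ofReal (by linarith)
  refine (MultiTaskRL.expect_run_bad_le P H adv _ (fun B => ∀ x ∈ Γ,
      N ≤ (MultiTaskRL.visitCount (B.take ⌊H₀⌋₊) x.1 x.2 : ℝ))
      (ENNReal.ofReal (1 - 1 / (2 * D)) ^ ⌊H₀⌋₊ * (4 ^ (Γ.card * ⌈N⌉₊) * 2))
      (fun past i s => ?_) K).trans ?_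
  · choose f hf1 hf2 hdrift using MultiTaskRL.exists_drift (P i) D hD1 (hD i)
    refine (MultiTaskRL.expect_mono _ fun x => ?_).trans
      (MultiTaskRL.expect_rollout_bad_le (P i) f _ hq4 hf1 hf2 hdrift Γ N ⌊H₀⌋₊ H
        (Nat.floor_le_of_le hH) _ (fun B s hB a ha => ?_) s)
    · rw [Set.indicator_apply]
      simp only [Set.mem_ofPred_eq, MultiTaskRL.deficit_eq_zero_iff, Pi.one_apply]
      split_ifs <;> simp_all
    · rw [MultiTaskRL.twoPhase, if_pos hB] at ha
      exact hexplore past B s a ha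
  · have hb := MultiTaskRL.failure_bound D N p₁ Γ.card (Fintype.card S) K ⌊H₀⌋₊ lam hlam hlam2
      hp₀ hp₁ hD1 (Finset.card_pos.2 ⟨x₀, hx₀⟩) Fintype.card_pos hK hN (by rw [hH₀])
    refine le_trans (le_of_eq ?_) (ENNReal.ofReal_le_ofReal hb)
    have hq0 : 0 ≤ 1 - 1 / (2 * D) := by linarith
    rw [ENNReal.ofReal_mul (by positivity), ENNReal.ofReal_mul (by positivity),
      ENNReal.ofReal_mul (by positivity), ENNReal.ofReal_pow hq0,
      ENNReal.ofReal_pow (by norm_num), ENNReal.ofReal_natCast]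
    simp
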